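/- Let $\delta_m=(m-1,m-2,\ldots,1)$ denote the staircase partition, with $\delta_0=\delta_1=\varnothing$, and for $n\ge 1$ let $\sigma_n=\delta_{n+1}/\delta_{n-1}$ be the zigzag skew shape. For a skew shape $\lambda/\mu$, where $\lambda=(\lambda_1,\ldots,\lambda_d)$ has $d$ (positive) parts, let $\mathrm{SSYT}(\mu,d)$ be the set of semistandard Young tableaux of shape $\mu$ with entries in $\{1,\ldots,d\}$, and for a cell $u=(i,j)$ let $c(u)=j-i$. The Okounkov--Olshanski formula is $$f^{\lambda/\mu}=\frac{|\lambda/\mu|!}{\prod_{u\in[\lambda]}h(u)}\sum_{T\in \mathrm{SSYT}(\mu,d)}\ \prod_{u\in[\mu]}\bigl(\lambda_{d+1-T(u)}-c(u)\bigr),$$ where $f^{\lambda/\mu}$ is the number of standard Young tableaux of shape $\lambda/\mu$ and $h(u)$ is the hook length of $u$ in $\lambda$. An Okounkov--Olshanski tableau of shape $\lambda/\mu$ is a $T\in\mathrm{SSYT}(\mu,d)$ with $c(u)<\lambda_{d+1-T(u)}$ for all $u\in[\mu]$. Theorem. For every integer $n\ge 1$, the number of nonzero terms (that is, of $T\in \mathrm{SSYT}(\mu,d)$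 whose product is nonzero) in the Okounkov--Olshanski formula for $\lambda/\mu=\sigma_n$ and the number of Okounkov--Olshanski tableaux of shape $\sigma_n$ are both equal to the unsigned Genocchi number $$G_{2n}=2(-1)^{n-1}(4^n-1)B_{2n},$$ where $B_{2n}$ is the $2n$-th Bernoulli number. -/

import Mathlib

namespace OkounkovOlshanski

/-- The staircase partition `δ_n = (n-1, n-2, …, 1)` as a Young diagram. Cells are indexed from
`0`, so that the cells are the pairs `(i, j)` with `i + j + 1 < n`; `δ_0 = δ_1 = ∅`. -/
def staircase (n : ℕ) : YoungDiagram where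
  cells := (Finset.range n ×ˢ Finset.range n).filter fun c => c.1 + c.2 + 1 < n
  isLowerSet := by
    rintro ⟨a, b⟩ ⟨c, d⟩ h hab
    have h1 : c ≤ a := h.1
    have h2 : d ≤ b := h.2
    simp only [Finset.coe_filter, Finset.mem_product, Finset.mem_range, Set.mem_ofPred_eq] at hab ⊢
    omega

theorem mem_staircase {n i j : ℕ} : (i, j) ∈ staircase n ↔ i + j + 1 < n := by
  rw [← YoungDiagram.mem_cells]
  simp only [staircase, Finset.mem_filter, Finset.mem_product, Finset.mem_range]
  omega

theorem rowLen_staircase (n i : ℕ) : (staircase n).rowLen i = n - 1 - i := by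
  apply Nat.le_antisymm
  · by_contra! h
    have := mem_staircase.1 (YoungDiagram.mem_iff_lt_rowLen.2 h)
    omega
  · by_contra! h
    have : (i, (staircase n).rowLen i) ∈ staircase n := mem_staircase.2 (by omega)
    exact lt_irrefl _ (YoungDiagram.mem_iff_lt_rowLen.1 this)

/-- Staircases are nested, so that `δ_n / δ_m` is a skew shape for `m ≤ n`. -/
theorem staircase_mono {m n : ℕ} (h : m ≤ n) : staircase m ≤ staircase n := by
  rintro ⟨i, j⟩ hc
  exact mem_staircase.2 (lt_of_lt_of_le (mem_staircase.1 hc) h)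

/-- The content `c(u) = j - i` of the cell `u = (i, j)`. -/
def content (u : ℕ × ℕ) : ℤ := (u.2 : ℤ) - (u.1 : ℤ)

/-- `SSYT(μ, d)`: the semistandard Young tableaux of shape `μ` with all entries in `{1, …, d}`.
(Mathlib's tableaux may also have the entry `0` in cells of `μ`.) -/
def boundedSSYT (μ : YoungDiagram) (d : ℕ) : Set (SemistandardYoungTableau μ) :=
  {T | ∀ u ∈ μ.cells, 1 ≤ T u.1 u.2 ∧ T u.1 u.2 ≤ d}

/-- The factor `λ_{d + 1 - k} - c(u)`, where `d = ℓ(lam)` is the number of rows of `lam` and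
`1 ≤ k ≤ d`. Rows of a Young diagram are indexed from `0` here, so that the part `λ_{d + 1 - k}`
is the length of the row with index `d - k`. -/
def weight (lam : YoungDiagram) (u : ℕ × ℕ) (k : ℕ) : ℤ :=
  (lam.rowLen (lam.colLen 0 - k) : ℤ) - content u

/-- The term `∏_{u ∈ [μ]} (λ_{d + 1 - T(u)} - c(u))` of the tableau `T` in the
Okounkov–Olshanski formula
`f^{λ/μ} = |λ/μ|! / (∏_{u ∈ [λ]} h(u)) * ∑_{T ∈ SSYT(μ, d)} ∏_{u ∈ [μ]} (λ_{d + 1 - T(u)} - c(u))`,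
where `d = ℓ(λ)`. -/
def term (lam μ : YoungDiagram) (T : SemistandardYoungTableau μ) : ℤ :=
  ∏ u ∈ μ.cells, weight lam u (T u.1 u.2)

/-- The number of nonzero terms of the Okounkov–Olshanski formula of the shape `lam / μ`. -/
noncomputable def numNonzeroTerms (lam μ : YoungDiagram) : ℕ :=
  {T : SemistandardYoungTableau μ | T ∈ boundedSSYT μ (lam.colLen 0) ∧ term lam μ T ≠ 0}.ncard

/-- The Okounkov–Olshanski tableaux of the shape `lam / μ`: the `T ∈ SSYT(μ, d)`, `d = ℓ(lam)`,
such that `c(u) < λ_{d + 1 - T(u)}` for all `u ∈ [μ]`. -/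
def tableaux (lam μ : YoungDiagram) : Set (SemistandardYoungTableau μ) :=
  {T | T ∈ boundedSSYT μ (lam.colLen 0) ∧
    ∀ u ∈ μ.cells, content u < (lam.rowLen (lam.colLen 0 - T u.1 u.2) : ℤ)}

/-- The unsigned Genocchi number `G_{2n} = 2 (-1)^{n-1} (4^n - 1) B_{2n}`, for `n ≥ 1`
(the sign is written as `(-1)^{n+1}`). -/
def genocchi (n : ℕ) : ℚ :=
  2 * (-1) ^ (n + 1) * (4 ^ n - 1) * bernoulli (2 * n)

end OkounkovOlshanski

namespace OkounkovOlshanski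

open Finset

/-! Let n = m + 2. The conditions on an Okounkov–Olshanski tableau, with strictness down columns,
force i + j + 1 ≤ T(i,j) ≤ i + j + 3. The excess over i + j + 1 increases weakly down a column, so
the column of length L is given by thresholds a_L ≤ b_L ≤ L. Row monotonicity only forbids excess 2
directly left of excess 0, that is, it says a_L ≤ b_{L+1}. Tableaux thus correspond to alternating
sequences (`exists_tableau_eq`). Counting these sequences by their last term gives Seidel's
triangle. Up to sign its entries and partial sums fill antidiagonals of the Euler–Seidel matrix of
2t/(e^t + 1) (`triangle_eq_seidel`): the recursions agree, and the boundary values are the zero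
diagonal and the zero odd Genocchi numbers. The full row sum is then ±g_{2m+4}. -/

/-! ### Genocchi numbers and their generating function -/

/-- The signed Genocchi numbers, with exponential generating function `2t / (e^t + 1)`. -/
def signedGenocchi (m : ℕ) : ℚ := 2 * (1 - 2 ^ m) * bernoulli m

/-- The exponential generating function of the signed Genocchi numbers. -/
noncomputable def genocchiPowerSeries : PowerSeries ℚ :=
  PowerSeries.mk fun m => signedGenocchi m / (m.factorial : ℚ)

theorem genocchiPowerSeries_eq : genocchiPowerSeries =
    2 * bernoulliPowerSeries ℚ - 2 * PowerSeries.rescale 2 (bernoulliPowerSeries ℚ) := by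
  ext m
  have h2 : (2 : PowerSeries ℚ) = PowerSeries.C 2 := (map_ofNat PowerSeries.C 2).symm
  simp only [genocchiPowerSeries, signedGenocchi, bernoulliPowerSeries, h2, map_sub,
    PowerSeries.coeff_C_mul, PowerSeries.coeff_rescale, PowerSeries.coeff_mk,
    Algebra.algebraMap_self, RingHom.id_apply]
  ring

theorem genocchiPowerSeries_mul_exp_add_one :
    genocchiPowerSeries * (PowerSeries.exp ℚ + 1) = 2 * PowerSeries.X := by
  have h1 := bernoulliPowerSeries_mul_exp_sub_one ℚ
  have h2 := congrArg (PowerSeries.rescale (2 : ℚ)) h1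
  have h3 := PowerSeries.exp_pow_eq_rescale_exp (A := ℚ) 2
  rw [Nat.cast_ofNat] at h3
  rw [map_mul, map_sub, map_one, ← h3, PowerSeries.rescale_X] at h2
  have h4 : (PowerSeries.C (2 : ℚ)) = 2 := map_ofNat PowerSeries.C 2
  rw [h4] at h2
  have h5 : PowerSeries.exp ℚ - 1 ≠ 0 := by
    intro h
    rw [h, mul_zero] at h1
    exact PowerSeries.X_ne_zero h1.symm
  -- After multiplication by e^t - 1, both Bernoulli identities, at t and at 2t, apply.
  refine mul_right_cancel₀ h5 ?_
  rw [genocchiPowerSeries_eq]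
  linear_combination 2 * (PowerSeries.exp ℚ + 1) * h1 - 2 * h2

theorem sum_choose_mul_signedGenocchi (m : ℕ) :
    ∑ i ∈ range (m + 1), (m.choose i : ℚ) * signedGenocchi i + signedGenocchi m =
      if m = 1 then 2 else 0 := by
  have h := congrArg (PowerSeries.coeff m) genocchiPowerSeries_mul_exp_add_one
  have h4 : (2 : PowerSeries ℚ) = PowerSeries.C (2 : ℚ) :=
    (map_ofNat PowerSeries.C 2).symm
  have hm : (m.factorial : ℚ) ≠ 0 := mod_cast m.factorial_ne_zero
  rw [h4, PowerSeries.coeff_C_mul, PowerSeries.coeff_X, mul_add, mul_one, map_add,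
    PowerSeries.coeff_mul, Nat.sum_antidiagonal_eq_sum_range_succ_mk] at h
  simp only [genocchiPowerSeries, PowerSeries.coeff_mk, PowerSeries.coeff_exp,
    Algebra.algebraMap_self, RingHom.id_apply] at h
  have h6 := congrArg (fun x => (m.factorial : ℚ) * x) h
  simp only [mul_add, mul_sum] at h6
  rw [mul_div_cancel₀ _ hm] at h6
  have h7 : ∀ i ∈ range (m + 1), (m.choose i : ℚ) * signedGenocchi i = (m.factorial : ℚ) *
      (signedGenocchi i / (i.factorial : ℚ) * (1 / ((m - i).factorial : ℚ))) := by
    intro i hi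
    rw [Nat.cast_choose ℚ (Nat.lt_succ_iff.1 (mem_range.1 hi))]
    ring
  rw [sum_congr rfl h7, h6]
  split_ifs with hm1
  · simp [hm1]
  · simp

theorem signedGenocchi_odd {m : ℕ} (hm : Odd m) (h : 1 < m) : signedGenocchi m = 0 := by
  rw [signedGenocchi, bernoulli_eq_zero_of_odd hm h, mul_zero]

theorem genocchi_eq_signedGenocchi (n : ℕ) :
    genocchi n = (-1) ^ n * signedGenocchi (2 * n) := by
  rw [genocchi, signedGenocchi, pow_mul, pow_succ]
  norm_num
  ring

/-! ### Euler–Seidel matrix -/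

/-- The Euler–Seidel matrix of the signed Genocchi numbers. -/
def seidel (n k : ℕ) : ℚ :=
  ∑ i ∈ range (k + 1), (k.choose i : ℚ) * signedGenocchi (n + i)

theorem seidel_zero_right (n : ℕ) : seidel n 0 = signedGenocchi n := by simp [seidel]

theorem seidel_succ (n k : ℕ) : seidel n (k + 1) = seidel n k + seidel (n + 1) k := by
  have := sum_choose_succ_mul (fun i _ => signedGenocchi (n + i)) k
  simp only [seidel]
  rw [this]
  simp only [add_assoc, add_comm 1]

/-- The first row is the first column up to sign, by the functional equation of 2t/(e^t + 1); the
recursion carries this to all entries. -/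
theorem seidel_symm (k n : ℕ) : seidel n k = -(-1) ^ (n + k) * seidel k n := by
  induction k generalizing n with
  | zero =>
    have h := sum_choose_mul_signedGenocchi n
    have h0 : seidel 0 n = ∑ i ∈ range (n + 1), (n.choose i : ℚ) * signedGenocchi i := by
      simp [seidel]
    rw [← h0] at h
    rw [seidel_zero_right, add_zero]
    rcases Nat.even_or_odd n with he | ho
    · rw [he.neg_one_pow]
      rw [if_neg (by rintro rfl; simp at he)] at h
      linarith
    · rw [ho.neg_one_pow]
      split_ifs at h with h1
      · subst h1
        norm_num [signedGenocchi] at h ⊢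
        linarith
      · have := signedGenocchi_odd ho (by have := ho.pos; omega)
        linarith
  | succ k ih =>
    have h1 := seidel_succ k n
    rw [seidel_succ, ih n, ih (n + 1), h1]
    ring

theorem seidel_diag (n : ℕ) : seidel n n = 0 := by
  have := seidel_symm n n
  rw [← two_mul, pow_mul] at this
  norm_num at this
  linarith

/-! ### Seidel triangle -/

/-- The numbers in the Seidel triangle: the number of alternating sequences
`b_1 ≥ a_1 ≤ b_2 ≥ a_2 ≤ ⋯ ≤ b_r ≥ a_r` of natural numbers with `b_L ≤ L` and `a_r = v`. -/
def triangle : ℕ → ℕ → ℕ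
  | 0, v => if v = 0 then 1 else 0
  | r + 1, v => ∑ b ∈ Icc v (r + 1), ∑ a ∈ range (b + 1), triangle r a

/-- Partial sums move from antidiagonal 2r + 3 to 2r + 4. The zero diagonal entry at (r + 2, r + 2)
starts the summation. -/
theorem sum_triangle_of_triangle {r : ℕ}
    (h : ∀ v ≤ r + 1, (-1) ^ (r + 1) * (triangle r v : ℚ) = seidel (r + 2 + v) (r + 1 - v))
    (b : ℕ) (hb : b ≤ r + 1) :
    (-1) ^ r * ∑ a ∈ range (b + 1), (triangle r a : ℚ) = seidel (r + 3 + b) (r + 1 - b) := by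
  induction b with
  | zero =>
    have h0 := h 0 (by omega)
    have h1 := seidel_succ (r + 2) (r + 1)
    have h2 : seidel (r + 2) (r + 1 + 1) = 0 := seidel_diag (r + 2)
    simp only [zero_add, sum_range_one, add_zero, Nat.sub_zero] at h0 ⊢
    rw [h2, ← h0, pow_succ] at h1
    have e : r + 2 + 1 = r + 3 := rfl
    rw [e] at h1
    linarith
  | succ b ih =>
    have h0 := h (b + 1) hb
    have h1 := ih (by omega)
    have h2 := seidel_succ (r + 3 + b) (r - b)
    have e1 : r - b + 1 = r + 1 - b := by omega
    have e2 : r + 1 - (b + 1) = r - b := by omega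
    have e3 : r + 2 + (b + 1) = r + 3 + b := by omega
    rw [e2, e3] at h0
    rw [e1] at h2
    rw [sum_range_succ, e2, ← add_assoc, mul_add, h1, h2, ← h0, pow_succ]
    ring

theorem triangle_eq_seidel (r v : ℕ) (hv : v ≤ r + 1) :
    (-1) ^ (r + 1) * (triangle r v : ℚ) = seidel (r + 2 + v) (r + 1 - v) := by
  induction r generalizing v with
  | zero =>
    interval_cases v
    · norm_num [triangle, seidel, sum_range_succ, signedGenocchi,
        bernoulli_eq_zero_of_odd (show Odd 3 by decide)]
    · norm_num [triangle, seidel, sum_range_succ, signedGenocchi,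
        bernoulli_eq_zero_of_odd (show Odd 3 by decide)]
  | succ r ih =>
    have h := sum_triangle_of_triangle (fun v hv => ih v hv)
    have hodd : seidel (r + 1 + 2 + (r + 2)) 0 = 0 := by
      rw [seidel_zero_right]
      exact signedGenocchi_odd ⟨r + 2, by ring⟩ (by omega)
    -- The sum over b ≥ v is built downwards from v = r + 2, where it is empty and the matrix entry
    -- is an odd Genocchi number.
    induction hv using Nat.decreasingInduction with
    | self => simpa [triangle] using hodd.symm
    | of_succ v hv ih2 =>
      have hv' : v ≤ r + 1 := by omega
      have e : triangle (r + 1) v =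
          ∑ a ∈ range (v + 1), triangle r a + triangle (r + 1) (v + 1) := by
        rw [triangle, triangle, ← insert_Icc_add_one_left_eq_Icc hv', sum_insert (by simp)]
      have h1 := h v hv'
      have h2 := seidel_succ (r + 3 + v) (r + 1 - v)
      have e1 : r + 1 - v + 1 = r + 1 + 1 - v := by omega
      have e2 : r + 1 + 1 - (v + 1) = r + 1 - v := by omega
      have e3 : r + 1 + 2 + (v + 1) = r + 3 + v + 1 := by omega
      have e4 : r + 1 + 2 + v = r + 3 + v := by omega
      rw [e1] at h2
      rw [e2, e3] at ih2
      rw [e4, h2, ← ih2, ← h1, e]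
      push_cast
      ring

theorem triangle_eq_zero {r v : ℕ} (h : r < v) : triangle r v = 0 := by
  cases r with
  | zero => rw [triangle, if_neg (by omega)]
  | succ r => rw [triangle, Icc_eq_empty (by omega), sum_empty]

theorem sum_triangle (m : ℕ) :
    ((∑ a ∈ range (m + 1), triangle m a : ℕ) : ℚ) = genocchi (m + 2) := by
  have h := sum_triangle_of_triangle (triangle_eq_seidel m) (m + 1) le_rfl
  rw [sum_range_succ, triangle_eq_zero (Nat.lt_succ_self m), Nat.sub_self, seidel_zero_right] at h
  have e : m + 3 + (m + 1) = 2 * (m + 2) := by ring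
  rw [genocchi_eq_signedGenocchi, ← e, ← h, pow_add]
  push_cast
  rw [add_zero, ← mul_assoc]
  have : ((-1 : ℚ) ^ m * (-1) ^ 2) * (-1) ^ m = 1 := by
    rw [mul_right_comm, ← mul_pow]; norm_num
  rw [this, one_mul]

/-! ### Enumeration of alternating sequences -/

open Classical in
/-- The alternating sequences counted by `triangle r v`, as the functions `L ↦ (a_L, b_L)`
vanishing at `0` and above `r`. -/
noncomputable def altSeq : ℕ → ℕ → Finset (ℕ → ℕ × ℕ)
  | 0, v => if v = 0 then {0} else ∅
  | r + 1, v => (Icc v (r + 1)).biUnion fun b => (range (b + 1)).biUnion fun a =>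
      (altSeq r a).image fun f => Function.update f (r + 1) (v, b)

/-- The inequalities that define alternating sequences. -/
structure IsAltSeq (r : ℕ) (f : ℕ → ℕ × ℕ) : Prop where
  zero : f 0 = 0
  above : ∀ L, r < L → f L = 0
  le : ∀ L < r, (f (L + 1)).1 ≤ (f (L + 1)).2
  le_self : ∀ L < r, (f (L + 1)).2 ≤ L + 1
  le_succ : ∀ L < r, (f L).1 ≤ (f (L + 1)).2

theorem mem_altSeq {r v : ℕ} {f : ℕ → ℕ × ℕ} :
    f ∈ altSeq r v ↔ IsAltSeq r f ∧ (f r).1 = v := by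
  induction r generalizing v f with
  | zero =>
    constructor
    · intro h
      rw [altSeq] at h
      split_ifs at h with hv
      · rw [mem_singleton] at h
        subst h hv
        exact ⟨⟨rfl, fun _ _ => rfl, by simp, by simp, by simp⟩, rfl⟩
      · simp at h
    · rintro ⟨h, rfl⟩
      have hf : f = 0 := by
        funext L
        rcases Nat.eq_zero_or_pos L with rfl | hL
        · exact h.zero
        · exact h.above L hL
      simp [altSeq, hf]
  | succ r ih =>
    simp only [altSeq, mem_biUnion, mem_image, mem_Icc, mem_range]
    constructor
    · rintro ⟨b, ⟨hvb, hbr⟩, a, hab, g, hg, rfl⟩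
      have hgv := (ih.1 hg).2
      replace hg := (ih.1 hg).1
      subst hgv
      have hne : ∀ L, L ≠ r + 1 → Function.update g (r + 1) (v, b) L = g L :=
        fun L hL => Function.update_of_ne hL _ _
      refine ⟨⟨?_, ?_, ?_, ?_, ?_⟩, by simp⟩
      · rw [hne 0 (by omega), hg.zero]
      · intro L hL
        rw [hne L (by omega), hg.above L (by omega)]
      · intro L hL
        rcases Nat.lt_succ_iff_lt_or_eq.1 hL with hL | rfl
        · rw [hne _ (by omega)]; exact hg.le L hL
        · simpa using hvb
      · intro L hL
        rcases Nat.lt_succ_iff_lt_or_eq.1 hL with hL | rfl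
        · rw [hne _ (by omega)]; exact hg.le_self L hL
        · simpa using hbr
      · intro L hL
        rw [hne L (by omega)]
        rcases Nat.lt_succ_iff_lt_or_eq.1 hL with hL | rfl
        · rw [hne _ (by omega)]; exact hg.le_succ L hL
        · simp only [Function.update_self]; omega
    · rintro ⟨h, rfl⟩
      have hne : ∀ L, L ≠ r + 1 → Function.update f (r + 1) 0 L = f L :=
        fun L hL => Function.update_of_ne hL _ _
      refine ⟨(f (r + 1)).2, ⟨h.le r (by omega), h.le_self r (by omega)⟩, (f r).1,
        Nat.lt_succ_of_le (h.le_succ r (by omega)), Function.update f (r + 1) 0,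
        ih.2 ⟨⟨?_, ?_, ?_, ?_, ?_⟩, ?_⟩, by simp⟩
      · rw [hne 0 (by omega), h.zero]
      · intro L hL
        by_cases hL1 : L = r + 1
        · rw [hL1, Function.update_self]
        · rw [hne L hL1, h.above L (by omega)]
      · intro L hL
        rw [hne _ (by omega)]; exact h.le L (by omega)
      · intro L hL
        rw [hne _ (by omega)]; exact h.le_self L (by omega)
      · intro L hL
        rw [hne _ (by omega), hne _ (by omega)]; exact h.le_succ L (by omega)
      · rw [hne _ (by omega)]

theorem card_altSeq (r v : ℕ) : #(altSeq r v) = triangle r v := by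
  classical
  induction r generalizing v with
  | zero => rw [altSeq, triangle]; split_ifs <;> rfl
  | succ r ih =>
    rw [altSeq, triangle, card_biUnion]
    · refine sum_congr rfl fun b _ => ?_
      rw [card_biUnion]
      · refine sum_congr rfl fun a _ => ?_
        rw [card_image_of_injOn, ih]
        intro f hf g hg hfg
        have hf' := (mem_altSeq.1 hf).1.above (r + 1) (Nat.lt_succ_self r)
        have hg' := (mem_altSeq.1 hg).1.above (r + 1) (Nat.lt_succ_self r)
        -- Resetting position r + 1 to its old value 0 undoes the update.
        have := congrArg (fun F => Function.update F (r + 1) 0) hfg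
        simp only [Function.update_idem] at this
        rwa [← hf', Function.update_eq_self, hf', ← hg', Function.update_eq_self] at this
      · intro a _ a' _ haa'
        rw [Function.onFun, disjoint_left]
        simp only [mem_image, not_exists, not_and]
        rintro _ ⟨f, hf, rfl⟩ g hg h
        have := congrFun h r
        rw [Function.update_of_ne (by omega), Function.update_of_ne (by omega)] at this
        exact haa' ((mem_altSeq.1 hf).2.symm.trans (this ▸ (mem_altSeq.1 hg).2))
    · intro b _ b' _ hbb'
      rw [Function.onFun, disjoint_left]
      simp only [mem_biUnion, mem_image, not_exists, not_and]
      rintro _ ⟨a, _, f, _, rfl⟩ a' _ g _ h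
      have := congrFun h (r + 1)
      simp only [Function.update_self, Prod.mk.injEq, true_and] at this
      exact hbb' this.symm

theorem IsAltSeq.fst_le {r : ℕ} {f : ℕ → ℕ × ℕ} (h : IsAltSeq r f) : (f r).1 ≤ r := by
  cases r with
  | zero => simp [h.zero]
  | succ r => exact (h.le r (by omega)).trans (h.le_self r (by omega))

theorem ncard_isAltSeq (m : ℕ) :
    {f | IsAltSeq m f}.ncard = ∑ a ∈ range (m + 1), triangle m a := by
  classical
  have : {f | IsAltSeq m f} = ((range (m + 1)).biUnion (altSeq m) : Finset (ℕ → ℕ × ℕ)) := by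
    ext f
    simp only [Set.mem_ofPred_eq, coe_biUnion, Set.mem_iUnion, mem_coe, mem_altSeq, mem_range]
    constructor
    · intro h
      exact ⟨(f m).1, Nat.lt_succ_of_le h.fst_le, h, rfl⟩
    · rintro ⟨_, _, h, _⟩
      exact h
  rw [this, Set.ncard_coe_finset, card_biUnion]
  · exact sum_congr rfl fun a _ => card_altSeq m a
  · intro a _ a' _ haa'
    rw [Function.onFun, disjoint_left]
    intro f hf hf'
    exact haa' ((mem_altSeq.1 hf).2.symm.trans (mem_altSeq.1 hf').2)

/-! ### Formula for staircase shapes -/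

theorem colLen_staircase (n : ℕ) : (staircase (n + 1)).colLen 0 = n := by
  apply Nat.le_antisymm
  · by_contra! h
    have := mem_staircase.1 (YoungDiagram.mem_iff_lt_colLen.2 h)
    omega
  · by_contra! h
    have : ((staircase (n + 1)).colLen 0, 0) ∈ staircase (n + 1) := mem_staircase.2 (by omega)
    exact lt_irrefl _ (YoungDiagram.mem_iff_lt_colLen.1 this)

/-- Counted from the bottom, the k-th row of δ_{n+1} has length k. -/
theorem weight_staircase {n k : ℕ} (u : ℕ × ℕ) (hk : k ≤ n) :
    weight (staircase (n + 1)) u k = k - content u := by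
  rw [weight, colLen_staircase, rowLen_staircase]
  congr 2
  omega

theorem mem_tableaux_staircase {n : ℕ} {μ : YoungDiagram} {T : SemistandardYoungTableau μ} :
    T ∈ tableaux (staircase (n + 1)) μ ↔
      ∀ i j, (i, j) ∈ μ → 1 ≤ T i j ∧ T i j ≤ n ∧ j < T i j + i := by
  simp only [tableaux, boundedSSYT, Set.mem_ofPred_eq, colLen_staircase, Prod.forall,
    YoungDiagram.mem_cells, rowLen_staircase, content]
  constructor
  · rintro ⟨h1, h2⟩ i j h
    have := h1 i j h
    have := h2 i j h
    omega
  · intro h1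
    refine ⟨fun i j h => ⟨(h1 i j h).1, (h1 i j h).2.1⟩, fun i j h => ?_⟩
    have := h1 i j h
    omega

/-- Along a row the factors decrease by at most one at each step, starting from a positive one, so
that they are positive if they do not vanish. -/
theorem numNonzeroTerms_staircase (n : ℕ) (μ : YoungDiagram) :
    numNonzeroTerms (staircase (n + 1)) μ = (tableaux (staircase (n + 1)) μ).ncard := by
  rw [numNonzeroTerms]
  congr 1
  ext T
  rw [mem_tableaux_staircase, Set.mem_ofPred_eq, boundedSSYT, Set.mem_ofPred_eq, term,
    prod_ne_zero_iff, colLen_staircase]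
  simp only [Prod.forall, YoungDiagram.mem_cells]
  constructor
  · rintro ⟨hb, hne⟩ i j
    induction j with
    | zero =>
      intro h
      have := hb i 0 h
      omega
    | succ j ih =>
      intro h
      have h' : (i, j) ∈ μ := μ.up_left_mem le_rfl (Nat.le_succ j) h
      have h1 := ih h'
      have h2 := hb i (j + 1) h
      have h3 := hne i (j + 1) h
      have h4 := T.row_weak (Nat.lt_add_one j) h
      rw [weight_staircase _ h2.2, content] at h3
      push_cast at h3
      omega
  · intro h
    refine ⟨fun i j hij => ⟨(h i j hij).1, (h i j hij).2.1⟩, fun i j hij => ?_⟩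
    have := h i j hij
    rw [weight_staircase _ this.2.1, content]
    push_cast
    omega

/-! ### Bijection between alternating sequences and tableaux -/

/-- The entry in the cell `(i, j)` of the tableau whose column of length `L` has the value
`i + j + 1` above row `a_L`, the value `i + j + 2` from there to row `b_L`, and the value
`i + j + 3` from row `b_L` on. -/
def altSeqEntry (m : ℕ) (f : ℕ → ℕ × ℕ) (i j : ℕ) : ℕ :=
  if i + j < m then
    i + j + 1 + (if (f (m - j)).1 ≤ i then 1 else 0) + (if (f (m - j)).2 ≤ i then 1 else 0)
  else 0

theorem altSeqEntry_of_lt {m : ℕ} (f : ℕ → ℕ × ℕ) {i j : ℕ} (h : i + j < m) :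
    altSeqEntry m f i j = i + j + 1 + (if (f (m - j)).1 ≤ i then 1 else 0) +
      (if (f (m - j)).2 ≤ i then 1 else 0) := if_pos h

theorem IsAltSeq.altSeqEntry_le_succ {m : ℕ} {f : ℕ → ℕ × ℕ} (h : IsAltSeq m f) {i j : ℕ}
    (hij : i + (j + 1) < m) : altSeqEntry m f i j ≤ altSeqEntry m f i (j + 1) := by
  have h1 := h.le_succ (m - (j + 1)) (by omega)
  rw [show m - (j + 1) + 1 = m - j by omega] at h1
  rw [altSeqEntry_of_lt f hij, altSeqEntry_of_lt f (by omega)]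
  split_ifs <;> omega

/-- The Okounkov–Olshanski tableau of an alternating sequence. -/
def IsAltSeq.tableau {m : ℕ} {f : ℕ → ℕ × ℕ} (h : IsAltSeq m f) :
    SemistandardYoungTableau (staircase (m + 1)) where
  entry := altSeqEntry m f
  row_weak' {i j1 j2} hj hc := by
    have hc := mem_staircase.1 hc
    clear * - h hj hc
    induction j2, hj using Nat.le_induction with
    | base => exact h.altSeqEntry_le_succ (by omega)
    | succ j hj ih => exact (ih (by omega)).trans (h.altSeqEntry_le_succ (by omega))
  col_strict' {i1 i2 j} hi hc := by
    have hc := mem_staircase.1 hc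
    rw [altSeqEntry_of_lt f (by omega), altSeqEntry_of_lt f (by omega)]
    split_ifs <;> omega
  zeros' {i j} hc := by
    rw [mem_staircase] at hc
    rw [altSeqEntry, if_neg (by omega)]

theorem IsAltSeq.tableau_apply {m : ℕ} {f : ℕ → ℕ × ℕ} (h : IsAltSeq m f) (i j : ℕ) :
    h.tableau i j = altSeqEntry m f i j := rfl

theorem IsAltSeq.tableau_mem {m : ℕ} {f : ℕ → ℕ × ℕ} (h : IsAltSeq m f) :
    h.tableau ∈ tableaux (staircase (m + 3)) (staircase (m + 1)) := by
  refine mem_tableaux_staircase.2 fun i j hij => ?_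
  rw [mem_staircase] at hij
  rw [h.tableau_apply, altSeqEntry_of_lt f (by omega)]
  split_ifs <;> omega

theorem IsAltSeq.tableau_injective {m : ℕ} {f g : ℕ → ℕ × ℕ} (hf : IsAltSeq m f)
    (hg : IsAltSeq m g) (h : hf.tableau = hg.tableau) : f = g := by
  funext L
  rcases Nat.eq_zero_or_pos L with rfl | hL
  · rw [hf.zero, hg.zero]
  by_cases hm : m < L
  · rw [hf.above L hm, hg.above L hm]
  obtain ⟨L, rfl⟩ : ∃ k, L = k + 1 := ⟨L - 1, by omega⟩
  have f1 := hf.le L (by omega)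
  have f2 := hf.le_self L (by omega)
  have g1 := hg.le L (by omega)
  have g2 := hg.le_self L (by omega)
  -- The excess in row i counts the thresholds at or below i; comparing it at the four thresholds
  -- themselves suffices.
  have key : ∀ i < L + 1,
      (if (f (L + 1)).1 ≤ i then 1 else 0) + (if (f (L + 1)).2 ≤ i then 1 else 0) =
      (if (g (L + 1)).1 ≤ i then 1 else 0) + (if (g (L + 1)).2 ≤ i then 1 else 0) := by
    intro i hi
    have h1 : altSeqEntry m f i (m - (L + 1)) = altSeqEntry m g i (m - (L + 1)) := by
      rw [← hf.tableau_apply, ← hg.tableau_apply, h]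
    rw [altSeqEntry_of_lt f (by omega), altSeqEntry_of_lt g (by omega),
      show m - (m - (L + 1)) = L + 1 by omega] at h1
    omega
  have k1 := key (f (L + 1)).1
  have k2 := key (f (L + 1)).2
  have k3 := key (g (L + 1)).1
  have k4 := key (g (L + 1)).2
  apply Prod.ext
  · split_ifs at k1 k3 <;> omega
  · split_ifs at k2 k4 <;> omega

/-- A down-closed predicate on the natural numbers below `L` holds up to a threshold. -/
theorem exists_threshold (p : ℕ → Prop) (L : ℕ) (hp : ∀ i, i + 1 < L → p (i + 1) → p i) :
    ∃ a ≤ L, ∀ i < L, (p i ↔ i < a) := by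
  induction L with
  | zero => exact ⟨0, le_rfl, by simp⟩
  | succ L ih =>
    obtain ⟨a, haL, ha⟩ := ih fun i hi => hp i (by omega)
    by_cases h : p L
    · refine ⟨L + 1, le_rfl, fun i hi => ⟨fun _ => hi, fun _ => ?_⟩⟩
      have : ∀ d ≤ L, p (L - d) := by
        intro d
        induction d with
        | zero => exact fun _ => h
        | succ d ihd =>
          intro hd
          refine hp _ (by omega) ?_
          rw [show L - (d + 1) + 1 = L - d by omega]
          exact ihd (by omega)
      rw [show i = L - (L - i) by omega]
      exact this _ (by omega)
    · refine ⟨a, by omega, fun i hi => ?_⟩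
      rcases Nat.lt_succ_iff_lt_or_eq.1 hi with hi | rfl
      · exact ha i hi
      · exact ⟨fun h' => absurd h' h, fun h' => by omega⟩

section

variable {m : ℕ} {T : SemistandardYoungTableau (staircase (m + 1))}

/-- The content condition gives the bound in the top row, and strictness carries it down. -/
theorem lt_entry_of_mem_tableaux (hT : T ∈ tableaux (staircase (m + 3)) (staircase (m + 1)))
    {i j : ℕ} (hij : i + j < m) : i + j < T i j := by
  rw [mem_tableaux_staircase] at hT
  induction i with
  | zero =>
    have := hT 0 j (mem_staircase.2 (by omega))
    omega
  | succ i ih =>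
    have h1 := ih (by omega)
    have h2 := T.col_strict (Nat.lt_add_one i)
      (mem_staircase.2 (show i + 1 + j + 1 < m + 1 by omega))
    omega

/-- The bottom cell of a column has i + j + 1 = m and entry at most m + 2; strictness carries this
bound up. -/
theorem entry_le_of_mem_tableaux (hT : T ∈ tableaux (staircase (m + 3)) (staircase (m + 1)))
    {i j : ℕ} (hij : i + j < m) : T i j ≤ i + j + 3 := by
  rw [mem_tableaux_staircase] at hT
  obtain ⟨d, hd⟩ : ∃ d, i + j + d + 1 = m := ⟨m - 1 - i - j, by omega⟩
  clear hij
  induction d generalizing i with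
  | zero =>
    have := hT i j (mem_staircase.2 (by omega))
    omega
  | succ d ih =>
    have h1 := ih (i := i + 1) (by omega)
    have h2 := T.col_strict (Nat.lt_add_one i)
      (mem_staircase.2 (show i + 1 + j + 1 < m + 1 by omega))
    omega

theorem exists_tableau_eq (hT : T ∈ tableaux (staircase (m + 3)) (staircase (m + 1))) :
    ∃ (f : ℕ → ℕ × ℕ) (h : IsAltSeq m f), h.tableau = T := by
  have lower {i j : ℕ} := lt_entry_of_mem_tableaux hT (i := i) (j := j)
  have upper {i j : ℕ} := entry_le_of_mem_tableaux hT (i := i) (j := j)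
  have step {i j : ℕ} (hij : i + 1 + j < m) : T i j < T (i + 1) j :=
    T.col_strict (Nat.lt_add_one i) (mem_staircase.2 (by omega))
  have row {i j : ℕ} (hij : i + (j + 1) < m) : T i j ≤ T i (j + 1) :=
    T.row_weak (Nat.lt_add_one j) (mem_staircase.2 (by omega))
  -- The case k = 1 yields a_L and k = 2 yields b_L. The guard L ≤ m sits inside so that `choose`
  -- gives functions on all of ℕ.
  have hcol (k : ℕ) (hk : 1 ≤ k) (L : ℕ) : ∃ a ≤ L, L ≤ m →
      ∀ i < L, (T i (m - L) ≤ i + (m - L) + k ↔ i < a) := by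
    by_cases hL : L ≤ m
    · obtain ⟨a, h1, h2⟩ := exists_threshold (fun i => T i (m - L) ≤ i + (m - L) + k) L
        (fun i hi h => by have := step (i := i) (j := m - L) (by omega); omega)
      exact ⟨a, h1, fun _ => h2⟩
    · exact ⟨0, by omega, fun h => absurd h hL⟩
  choose a ha haT using hcol 1 le_rfl
  choose b hb hbT using hcol 2 (by omega)
  have hab : ∀ L ≤ m, a L ≤ b L := by
    intro L hL
    by_contra! hlt
    have h1 := haT L hL (b L) (by have := ha L; omega)
    have h2 := hbT L hL (b L) (by have := ha L; omega)
    omega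
  let f : ℕ → ℕ × ℕ := fun L => if L ≤ m then (a L, b L) else 0
  have hf : ∀ L ≤ m, f L = (a L, b L) := fun L hL => if_pos hL
  have hF : IsAltSeq m f := by
    refine ⟨?_, fun L hL => if_neg (by omega), fun L hL => ?_, fun L hL => ?_, fun L hL => ?_⟩
    · have h1 := ha 0
      have h2 := hb 0
      rw [hf 0 (Nat.zero_le m)]
      exact Prod.ext (by simpa using h1) (by simpa using h2)
    · rw [hf _ hL]; exact hab _ hL
    · rw [hf _ hL]; exact hb _
    · rw [hf _ hL, hf _ hL.le]
      change a L ≤ b (L + 1)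
      -- In row b_{L+1} the longer column would have excess 2 and its right neighbour excess 0.
      by_contra! hlt
      have h0 := ha L
      have h1 := haT L hL.le (b (L + 1)) (by omega)
      have h2 := hbT (L + 1) hL (b (L + 1)) (by omega)
      have h3 := row (i := b (L + 1)) (j := m - (L + 1)) (by omega)
      rw [show m - (L + 1) + 1 = m - L by omega] at h3
      omega
  refine ⟨f, hF, ?_⟩
  ext i j
  rw [hF.tableau_apply, altSeqEntry]
  split_ifs with hij
  all_goals try rw [hf _ (Nat.sub_le m j)] at *
  pick_goal 5
  · exact (T.zeros (by rw [mem_staircase]; omega)).symm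
  all_goals
    have h1 := haT (m - j) (Nat.sub_le m j) i (by omega)
    have h2 := hbT (m - j) (Nat.sub_le m j) i (by omega)
    rw [show m - (m - j) = j by omega] at h1 h2
    have h3 := lower hij
    have h4 := upper hij
    have h5 := hab (m - j) (Nat.sub_le m j)
    simp only at *
    omega

end

/-! ### Final count -/

theorem ncard_tableaux_staircase (m : ℕ) :
    (tableaux (staircase (m + 3)) (staircase (m + 1))).ncard =
      ∑ a ∈ range (m + 1), triangle m a := by
  rw [← ncard_isAltSeq]
  refine (Set.ncard_congr (fun f (hf : IsAltSeq m f) => hf.tableau) (fun f hf => hf.tableau_mem)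
    (fun f g hf hg h => hf.tableau_injective hg h) fun T hT => ?_).symm
  exact exists_tableau_eq hT

theorem ncard_tableaux_staircase_two_zero :
    (tableaux (staircase 2) (staircase 0)).ncard = 1 := by
  rw [Set.ncard_eq_one]
  have h0 : ∀ i j, (i, j) ∉ staircase 0 := fun i j h => by
    have := mem_staircase.1 h; omega
  refine ⟨SemistandardYoungTableau.highestWeight _, Set.ext fun T => ?_⟩
  rw [mem_tableaux_staircase, Set.mem_singleton_iff]
  refine ⟨fun _ => ?_, fun _ i j h => absurd h (h0 i j)⟩
  ext i j
  rw [T.zeros (h0 i j), SemistandardYoungTableau.zeros _ (h0 i j)]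

end OkounkovOlshanski

theorem mainTheorem8 (n : ℕ) (hn : 1 ≤ n) :
    (OkounkovOlshanski.numNonzeroTerms (OkounkovOlshanski.staircase (n + 1))
        (OkounkovOlshanski.staircase (n - 1)) : ℚ) = OkounkovOlshanski.genocchi n ∧
      ((OkounkovOlshanski.tableaux (OkounkovOlshanski.staircase (n + 1))
        (OkounkovOlshanski.staircase (n - 1))).ncard : ℚ) = OkounkovOlshanski.genocchi n := by
  rw [OkounkovOlshanski.numNonzeroTerms_staircase, and_self]
  -- For n = 1 the inner shape is δ_0, which is not of the form δ_{m+1}.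
  obtain rfl | ⟨m, rfl⟩ : n = 1 ∨ ∃ m, n = m + 2 := by
    rcases hn.eq_or_lt with h | h
    · exact Or.inl h.symm
    · exact Or.inr ⟨n - 2, by omega⟩
  · rw [OkounkovOlshanski.ncard_tableaux_staircase_two_zero]
    norm_num [OkounkovOlshanski.genocchi]
  · exact (congrArg Nat.cast (OkounkovOlshanski.ncard_tableaux_staircase m)).trans
      (OkounkovOlshanski.sum_triangle m)
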